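/- Consider spinless fermion modes, some held by Alice and some by Bob, with creation operators $a_i^\dagger$, $b_i^\dagger$ satisfying the canonical anticommutation relations. A *parity-respecting LOCC protocol* is a finite sequence of rounds in which one of the parties applies a local quantum instrument with finitely many outcomes and announces the outcome, on which the later rounds may depend; every Kraus operator $K$ of an instrument maps the states of the party's local modes to states of a possibly different number of local modes, and commutes or anticommutes with the local parity $\prod_i(-1)^{n_i}$ (the anticommuting case comes from local ancillary modes). Let $\alpha,\beta\in\mathbb C$ with $|\alpha|^2+|\beta|^2=1$. An *e-mode* is the state $\alpha|0_A1_B\rangle+\beta|1_A0_B\rangle=(\alpha b^\dagger+\beta a^\dagger)|\mathrm{vac}\rangle$, and $N$ copies of it are $\prod_{i=1}^N(\alpha b_i^\dagger+\beta a_i^\dagger)|\mathrm{vac}\rangle$; it is *perfect* if $\alpha=\beta=1/\sqrt2$. Let $\rho_A$ be the reduced state of Alice for one e-mode and $S(\rho_A)=-\operatorname{tr}\rho_A\log_2\rho_A$. Then for every $\varepsilon>0$ there is $N_0$ such that for all $N\ge N_0$: (Concentration) there are an integer $k\ge 0$ with $|k-N\,S(\rho_A)|\le\varepsilon N$ and a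 parity-respecting LOCC protocol that converts $N$ copies of $\alpha|0_A1_B\rangle+\beta|1_A0_B\rangle$, with probability at least $1-\varepsilon$, exactly into $k$ perfect e-modes; (Dilution) there are an integer $k\ge 0$ with $|k-N\,S(\rho_A)|\le\varepsilon N$ and a parity-respecting LOCC protocol that converts $k$ perfect e-modes into a state whose fidelity $\langle\tau|\rho|\tau\rangle$ with $\tau$, the $N$ copies of $\alpha|0_A1_B\rangle+\beta|1_A0_B\rangle$, is at least $1-\varepsilon$. -/

import Mathlib

open scoped Kronecker

noncomputable section

namespace Fermion

/-- Occupation numbers of `n` local (spinless) fermion modes. -/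
abbrev Occ (n : ℕ) : Type := Fin n → Fin 2

/-- Total number of fermions in an occupation configuration. -/
def number {n : ℕ} (x : Occ n) : ℕ := ∑ i, (x i : ℕ)

/-- (Unnormalized) pure states of `a` modes of Alice and `b` modes of Bob, given by their amplitudes
in the occupation number basis. The basis vector `(x, y)` is obtained from the vacuum by applying
the creation operators of all occupied modes, Alice's modes (in increasing order) to the left of
Bob's modes (in increasing order). -/
abbrev State (a b : ℕ) : Type := Occ a × Occ b → ℂ

/-- The squared Hilbert space norm of a state. -/
def normSq {a b : ℕ} (ψ : State a b) : ℝ := ∑ p, ‖ψ p‖ ^ 2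

/-- The Hilbert space inner product, conjugate linear in the first argument. -/
def braket {a b : ℕ} (φ ψ : State a b) : ℂ := ∑ p, star (φ p) * ψ p

/-- The local parity operator `∏ i, (-1) ^ n_i`. -/
def parity (n : ℕ) : Matrix (Occ n) (Occ n) ℂ :=
  Matrix.diagonal fun x => (-1) ^ number x

/-- The creation operator of the `i`-th mode of a register of `n` modes. -/
def create {n : ℕ} (i : Fin n) : Matrix (Occ n) (Occ n) ℂ :=
  Matrix.of fun x' x =>
    if x i = 0 ∧ x' = Function.update x i 1 then (-1) ^ (∑ j ∈ Finset.Iio i, (x j : ℕ)) else 0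

/-- The creation operator of the `i`-th mode of Alice on the joint Fock space. -/
def aliceCreate {a b : ℕ} (i : Fin a) : Matrix (Occ a × Occ b) (Occ a × Occ b) ℂ :=
  create i ⊗ₖ 1

/-- The creation operator of the `i`-th mode of Bob on the joint Fock space. The parity of Alice's
modes makes it anticommute with Alice's creation operators. -/
def bobCreate {a b : ℕ} (i : Fin b) : Matrix (Occ a × Occ b) (Occ a × Occ b) ℂ :=
  parity a ⊗ₖ create i

/-- The joint vacuum. -/
def vacuum (a b : ℕ) : State a b := Pi.single (0, 0) 1

/-- `N` copies of the e-mode `α |0_A 1_B⟩ + β |1_A 0_B⟩`, that is,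
`(α b₁† + β a₁†) ⋯ (α b_N† + β a_N†) |vacuum⟩`. -/
def eModes (α β : ℂ) (N : ℕ) : State N N :=
  (List.ofFn fun i : Fin N => α • bobCreate i + β • aliceCreate i).prod.mulVec (vacuum N N)

/-- `k` perfect e-modes, `(|0_A 1_B⟩ + |1_A 0_B⟩) / √2` each. -/
def perfectEModes (k : ℕ) : State k k :=
  eModes ((1 / Real.sqrt 2 : ℝ) : ℂ) ((1 / Real.sqrt 2 : ℝ) : ℂ) k

/-- The reduced density matrix of Alice. -/
def reducedState {a b : ℕ} (ψ : State a b) : Matrix (Occ a) (Occ a) ℂ :=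
  Matrix.of fun x x' => ∑ y, ψ (x, y) * star (ψ (x', y))

theorem reducedState_isHermitian {a b : ℕ} (ψ : State a b) : (reducedState ψ).IsHermitian := by
  ext x x'
  simp [reducedState, Matrix.conjTranspose_apply, mul_comm]

/-- The von Neumann entropy `- tr (ρ log₂ ρ)`, in bits. -/
def vonNeumannEntropy {ι : Type} [Fintype ι] [DecidableEq ι] {ρ : Matrix ι ι ℂ}
    (hρ : ρ.IsHermitian) : ℝ :=
  ∑ i, Real.negMulLog (hρ.eigenvalues i) / Real.log 2

/-- The entropy of entanglement `S(ρ_A)` of a pure state. -/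
def entanglementEntropy {a b : ℕ} (ψ : State a b) : ℝ :=
  vonNeumannEntropy (reducedState_isHermitian ψ)

/-- Parity superselection rule for a Kraus operator of one party: it commutes or anticommutes with
the local parity. The second case comes from local ancillary modes of odd parity. -/
def RespectsParity {m n : ℕ} (K : Matrix (Occ m) (Occ n) ℂ) : Prop :=
  K * parity n = parity m * K ∨ K * parity n = -(parity m * K)

/-- A local quantum instrument with `r` outcomes obeying the parity superselection rule: adding
local ancillary modes, a local unitary and a measurement of some local modes. The `i`-th outcome
leaves `m i` local modes. -/
structure IsParityInstrument {n r : ℕ} {m : Fin r → ℕ}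
    (K : (i : Fin r) → Matrix (Occ (m i)) (Occ n) ℂ) : Prop where
  respectsParity : ∀ i, RespectsParity (K i)
  complete : ∑ i, (K i).conjTranspose * K i = 1

/-- Parity-respecting LOCC protocols of finitely many rounds. `LOCC a' b' a b` starts with `a` modes
of Alice and `b` modes of Bob and ends with `a'` modes of Alice and `b'` modes of Bob. In each round
one party applies a local instrument and announces the outcome, on which the rest of the protocol
may depend. A Kraus operator `L` of Bob acts as `1 ⊗ L`; on states of definite global parity, the only
physical ones, this agrees up to a sign with the action including the sign `(-1) ^ n_A` that Alice's
modes contribute to odd operators of Bob, composed with Bob's local parity. -/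
inductive LOCC (a' b' : ℕ) : ℕ → ℕ → Type
  | done : LOCC a' b' a' b'
  | alice {a b r : ℕ} (m : Fin r → ℕ) (K : (i : Fin r) → Matrix (Occ (m i)) (Occ a) ℂ)
      (hK : IsParityInstrument K) (next : (i : Fin r) → LOCC a' b' (m i) b) : LOCC a' b' a b
  | bob {a b r : ℕ} (m : Fin r → ℕ) (K : (i : Fin r) → Matrix (Occ (m i)) (Occ b) ℂ)
      (hK : IsParityInstrument K) (next : (i : Fin r) → LOCC a' b' a (m i)) : LOCC a' b' a b

/-- Sum, over all sequences of measurement outcomes of the protocol started in `ψ`, of `F` at the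
unnormalized final state (whose squared norm is the probability of that sequence). -/
def LOCC.sumOutcomes {a' b' : ℕ} (F : State a' b' → ℝ) :
    {a b : ℕ} → LOCC a' b' a b → State a b → ℝ
  | _, _, .done, ψ => F ψ
  | _, _, .alice _ K _ next, ψ => ∑ i, (next i).sumOutcomes F ((K i ⊗ₖ 1).mulVec ψ)
  | _, _, .bob _ K _ next, ψ => ∑ i, (next i).sumOutcomes F ((1 ⊗ₖ K i).mulVec ψ)

open Classical in
/-- The probability that the protocol, started in `ψ`, ends exactly in the state `τ` (up to
normalization and a global phase). -/
def LOCC.successProb {a' b' a b : ℕ} (P : LOCC a' b' a b) (ψ : State a b) (τ : State a' b') : ℝ :=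
  P.sumOutcomes (fun φ => if ∃ c : ℂ, φ = c • τ then normSq φ else 0) ψ

/-- The fidelity `⟨τ| ρ |τ⟩` of the final mixed state `ρ` of the protocol, started in `ψ`, with the
pure state `τ`. -/
def LOCC.fidelity {a' b' a b : ℕ} (P : LOCC a' b' a b) (ψ : State a b) (τ : State a' b') : ℝ :=
  P.sumOutcomes (fun φ => ‖braket τ φ‖ ^ 2) ψ

end Fermion

end

noncomputable section

namespace Fermion

/-! In the occupation basis the N copies are an anticorrelated state `∑ x, c x |x, flip x⟩`, and `‖c
x‖ ^ 2` is the probability of `x` under N independent draws from (|α|², |β|²). The anticommutation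
signs only enter the phases of `c`, which Kraus coefficients can cancel. The entropy of one copy is
the Shannon entropy of this distribution, so the rates come from typicality as for qubits. The
fermionic difficulty is to respect parity.

One kind of round suffices (`exists_protocol`): Alice applies Kraus operators `∑ z, u z |z⟩⟨g z|`,
each preserving or reversing parity, and Bob undoes the matching relabelling on his complementary
configurations. The amplitudes `c` become `u z * c (g z)`.

Dilution (`exists_dilution_protocol`): embed the typical set in k + 1 modes, the extra mode making
the embedding preserve parity. The outcomes are the translates of this embedding; each yields the
target truncated to the typical set.

Concentration (`exists_concentration_protocol`): configurations with equal fermion number are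
equiprobable but share one parity, whereas perfect e-modes weigh both parities equally. So each
outcome joins an even block with an odd block of size 2 ^ k, and the success probability is twice
the smaller usable parity weight. When αβ ≠ 0 both parity weights tend to 1/2, and small number
classes carry negligible weight. When αβ = 0 the entropy vanishes and k = 0 works. -/

/-- The configuration in which exactly the empty modes of `x` are occupied. -/
def flip {n : ℕ} (x : Occ n) : Occ n := x + 1

theorem flip_flip {n : ℕ} (x : Occ n) : flip (flip x) = x := by
  funext i
  have : ∀ a : Fin 2, a + 1 + 1 = a := by decide
  exact this (x i)

theorem flip_injective {n : ℕ} : Function.Injective (flip (n := n)) :=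
  Function.LeftInverse.injective flip_flip

/-! ### Parity signs of configurations -/

theorem neg_one_pow_number {n : ℕ} (x : Occ n) :
    (-1 : ℂ) ^ number x = ∏ i, (-1 : ℂ) ^ (x i : ℕ) := by
  rw [number, Finset.prod_pow_eq_pow_sum]

theorem neg_one_pow_number_add {n : ℕ} (x y : Occ n) :
    (-1 : ℂ) ^ number (x + y) = (-1) ^ number x * (-1) ^ number y := by
  simp only [neg_one_pow_number, ← Finset.prod_mul_distrib]
  refine Finset.prod_congr rfl fun i _ => ?_
  have : ∀ a b : Fin 2, (-1 : ℂ) ^ ((a + b : Fin 2) : ℕ) = (-1) ^ (a : ℕ) * (-1) ^ (b : ℕ) := by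
    intro a b
    fin_cases a <;> fin_cases b <;> simp [show (1 + 1 : Fin 2) = 0 from rfl]
  exact this (x i) (y i)

theorem neg_one_pow_eq_or_neg (n : ℕ) : (-1 : ℂ) ^ n = 1 ∨ (-1 : ℂ) ^ n = -1 :=
  neg_one_pow_eq_or ℂ n

/-! ### Anticorrelated states -/

/-- The pure state `∑ x, c x |x, flip x⟩`. -/
def antiState {n : ℕ} (c : Occ n → ℂ) : State n n :=
  fun p => if p.2 = flip p.1 then c p.1 else 0

theorem normSq_antiState {n : ℕ} (c : Occ n → ℂ) : normSq (antiState c) = ∑ x, ‖c x‖ ^ 2 := by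
  simp only [normSq, antiState, Fintype.sum_prod_type]
  refine Finset.sum_congr rfl fun x _ => ?_
  rw [Finset.sum_eq_single (flip x)] <;> simp +contextual

theorem braket_antiState {n : ℕ} (c d : Occ n → ℂ) :
    braket (antiState c) (antiState d) = ∑ x, star (c x) * d x := by
  simp only [braket, antiState, Fintype.sum_prod_type]
  refine Finset.sum_congr rfl fun x _ => ?_
  rw [Finset.sum_eq_single (flip x)] <;> simp +contextual

theorem antiState_smul {n : ℕ} (a : ℂ) (c : Occ n → ℂ) :
    antiState (fun x => a * c x) = a • antiState c := by
  funext p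
  simp [antiState]

/-! ### Monomial Kraus operators and instruments -/

/-- The operator `∑ z, u z |z⟩⟨g z|`. -/
def monomial {m n : ℕ} (g : Occ m → Occ n) (u : Occ m → ℂ) : Matrix (Occ m) (Occ n) ℂ :=
  Matrix.of fun z x => if x = g z then u z else 0

/-- On the support of `u`, the map `g` either preserves the parity or reverses it. -/
def ParityCompatible {m n : ℕ} (g : Occ m → Occ n) (u : Occ m → ℂ) : Prop :=
  ∃ ε : ℂ, (ε = 1 ∨ ε = -1) ∧ ∀ z, u z ≠ 0 → (-1 : ℂ) ^ number (g z) = ε * (-1) ^ number z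

theorem ParityCompatible.respectsParity {m n : ℕ} {g : Occ m → Occ n} {u : Occ m → ℂ}
    (h : ParityCompatible g u) : RespectsParity (monomial g u) := by
  obtain ⟨ε, hε, h⟩ := h
  have key : monomial g u * parity n = ε • (parity m * monomial g u) := by
    ext z x
    simp only [monomial, parity, Matrix.mul_diagonal, Matrix.smul_apply, Matrix.diagonal_mul,
      Matrix.of_apply, smul_eq_mul]
    split_ifs with hx
    · by_cases hu : u z = 0
      · simp [hu]
      · rw [hx, h z hu]; ring
    · simp
  rcases hε with rfl | rfl
  · left; simpa using key
  · right; simpa using key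

/-- Each row of the operator has at most one nonzero entry, so distinct columns `x ≠ x'` never
overlap. Completeness thereby reduces to one scalar condition per basis vector. -/
theorem monomial_conjTranspose_mul {m n : ℕ} (g : Occ m → Occ n) (u : Occ m → ℂ) :
    (monomial g u).conjTranspose * monomial g u =
      Matrix.diagonal fun x => ((∑ z, if x = g z then ‖u z‖ ^ 2 else 0 : ℝ) : ℂ) := by
  ext x x'
  rw [Matrix.mul_apply, Matrix.diagonal_apply]
  by_cases hxx : x = x'
  · subst hxx
    rw [if_pos rfl, Complex.ofReal_sum]
    refine Finset.sum_congr rfl fun z _ => ?_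
    simp only [Matrix.conjTranspose_apply, monomial, Matrix.of_apply]
    split_ifs with h
    · rw [Complex.star_def, Complex.conj_mul']; norm_cast
    · simp
  · rw [if_neg hxx]
    refine Finset.sum_eq_zero fun z _ => ?_
    simp only [Matrix.conjTranspose_apply, monomial, Matrix.of_apply]
    split_ifs with h h'
    · exact absurd (h.trans h'.symm) hxx
    all_goals simp

/-- A subnormalized family of monomial Kraus operators extends to a parity-respecting
instrument. -/
theorem exists_isParityInstrument {m n : ℕ} {ι : Type} [Fintype ι] (g : ι → Occ m → Occ n)
    (u : ι → Occ m → ℂ) (hpar : ∀ i, ParityCompatible (g i) (u i))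
    (hsum : ∀ x, ∑ i, ∑ z, (if x = g i z then ‖u i z‖ ^ 2 else 0) ≤ 1) :
    ∃ (r : ℕ) (e : ι ⊕ Occ n ≃ Fin r) (K : Fin r → Matrix (Occ m) (Occ n) ℂ),
      IsParityInstrument (m := fun _ => m) K ∧ ∀ i, K (e (.inl i)) = monomial (g i) (u i) := by
  set d : Occ n → ℝ := fun x => 1 - ∑ i, ∑ z, (if x = g i z then ‖u i z‖ ^ 2 else 0) with hd
  have hd0 : ∀ x, 0 ≤ d x := fun x => sub_nonneg.2 (hsum x)
  -- The missing weight `d x` goes to `|0⟩⟨x|`, which has a single nonzero entry and hence a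
  -- definite parity type.
  let k : ι ⊕ Occ n → Matrix (Occ m) (Occ n) ℂ :=
    Sum.elim (fun i => monomial (g i) (u i))
      (fun x => monomial (fun _ => x) (Pi.single 0 ((Real.sqrt (d x) : ℝ) : ℂ)))
  let e := Fintype.equivFin (ι ⊕ Occ n)
  refine ⟨_, e, fun l => k (e.symm l), ⟨?_, ?_⟩, ?_⟩
  · intro l
    rcases e.symm l with i | x
    · exact (hpar i).respectsParity
    · refine ParityCompatible.respectsParity ⟨(-1) ^ number x, neg_one_pow_eq_or_neg _, ?_⟩
      intro z hz
      have hz0 : z = 0 := by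
        by_contra h
        exact hz (by simp [h])
      subst hz0
      simp [number]
  · rw [Equiv.sum_comp e.symm (fun s => (k s).conjTranspose * k s), Fintype.sum_sum_type]
    simp only [k, Sum.elim_inl, Sum.elim_inr, monomial_conjTranspose_mul]
    ext x x'
    simp only [Matrix.add_apply, Matrix.sum_apply, Matrix.diagonal_apply, Matrix.one_apply]
    split_ifs with hxx
    · subst hxx
      have h2 : ∑ y : Occ n, (∑ z : Occ m, if x = y then
          ‖(Pi.single 0 ((Real.sqrt (d y) : ℝ) : ℂ) : Occ m → ℂ) z‖ ^ 2 else 0) = d x := by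
        rw [Finset.sum_eq_single x, Finset.sum_eq_single 0]
        · simp [Real.sq_sqrt (hd0 x), abs_of_nonneg]
        · intro z _ hz; simp [hz]
        · simp
        · intro y _ hy; simp [Ne.symm hy]
        · simp
      rw [← Complex.ofReal_sum, ← Complex.ofReal_sum, h2, ← Complex.ofReal_add, hd]
      simp
    · simp
  · intro i; simp [k]

/-! ### One-round protocols -/

theorem LOCC.sumOutcomes_nonneg {a' b' : ℕ} {F : State a' b' → ℝ} (hF : ∀ φ, 0 ≤ F φ) :
    ∀ {a b : ℕ} (P : LOCC a' b' a b) (ψ : State a b), 0 ≤ P.sumOutcomes F ψ := by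
  intro a b P
  induction P with
  | done => intro ψ; exact hF ψ
  | alice m K hK next ih => intro ψ; exact Finset.sum_nonneg fun i _ => ih i _
  | bob m K hK next ih => intro ψ; exact Finset.sum_nonneg fun i _ => ih i _

/-- Only a lower bound: the completing outcomes continue with `fallback`, and their contribution to
a nonnegative `F` is dropped. -/
theorem exists_alice {a' b' m n b : ℕ} {ι : Type} [Fintype ι] (g : ι → Occ m → Occ n)
    (u : ι → Occ m → ℂ) (hpar : ∀ i, ParityCompatible (g i) (u i))
    (hsum : ∀ x, ∑ i, ∑ z, (if x = g i z then ‖u i z‖ ^ 2 else 0) ≤ 1)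
    (next : ι → LOCC a' b' m b) (fallback : LOCC a' b' m b) :
    ∃ P : LOCC a' b' n b, ∀ F : State a' b' → ℝ, (∀ φ, 0 ≤ F φ) → ∀ ψ,
      ∑ i, (next i).sumOutcomes F ((monomial (g i) (u i) ⊗ₖ 1).mulVec ψ) ≤ P.sumOutcomes F ψ := by
  obtain ⟨r, e, K, hK, hKe⟩ := exists_isParityInstrument g u hpar hsum
  refine ⟨.alice (fun _ => m) K hK
    (fun l => Sum.elim next (fun _ => fallback) (e.symm l)), fun F hF ψ => ?_⟩
  rw [LOCC.sumOutcomes, ← Equiv.sum_comp e, Fintype.sum_sum_type]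
  simp only [Equiv.symm_apply_apply, Sum.elim_inl, Sum.elim_inr, hKe]
  exact le_add_of_nonneg_right (Finset.sum_nonneg fun x _ => LOCC.sumOutcomes_nonneg hF _ _)

theorem exists_bob {a' b' m n a : ℕ} {ι : Type} [Fintype ι] (g : ι → Occ m → Occ n)
    (u : ι → Occ m → ℂ) (hpar : ∀ i, ParityCompatible (g i) (u i))
    (hsum : ∀ x, ∑ i, ∑ z, (if x = g i z then ‖u i z‖ ^ 2 else 0) ≤ 1)
    (next : ι → LOCC a' b' a m) (fallback : LOCC a' b' a m) :
    ∃ P : LOCC a' b' a n, ∀ F : State a' b' → ℝ, (∀ φ, 0 ≤ F φ) → ∀ ψ,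
      ∑ i, (next i).sumOutcomes F ((1 ⊗ₖ monomial (g i) (u i)).mulVec ψ) ≤ P.sumOutcomes F ψ := by
  obtain ⟨r, e, K, hK, hKe⟩ := exists_isParityInstrument g u hpar hsum
  refine ⟨.bob (fun _ => m) K hK
    (fun l => Sum.elim next (fun _ => fallback) (e.symm l)), fun F hF ψ => ?_⟩
  rw [LOCC.sumOutcomes, ← Equiv.sum_comp e, Fintype.sum_sum_type]
  simp only [Equiv.symm_apply_apply, Sum.elim_inl, Sum.elim_inr, hKe]
  exact le_add_of_nonneg_right (Finset.sum_nonneg fun x _ => LOCC.sumOutcomes_nonneg hF _ _)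

/-- Complementing all modes changes parity by a sign depending only on `n`, so Bob's relabelling is
parity compatible whenever Alice's is. -/
theorem neg_one_pow_number_flip {n : ℕ} (x : Occ n) :
    (-1 : ℂ) ^ number (flip x) = (-1) ^ n * (-1) ^ number x := by
  rw [flip, neg_one_pow_number_add, mul_comm]
  congr 2
  simp [number]

theorem kronecker_one_mulVec_apply {a a' b : ℕ} (K : Matrix (Occ a') (Occ a) ℂ) (ψ : State a b)
    (z : Occ a') (y : Occ b) : (K ⊗ₖ (1 : Matrix (Occ b) (Occ b) ℂ)).mulVec ψ (z, y) =
      ∑ x, K z x * ψ (x, y) := by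
  simp only [Matrix.mulVec, dotProduct, Fintype.sum_prod_type, Matrix.kroneckerMap_apply,
    Matrix.one_apply]
  refine Finset.sum_congr rfl fun x _ => ?_
  simp

theorem one_kronecker_mulVec_apply {a b b' : ℕ} (K : Matrix (Occ b') (Occ b) ℂ) (ψ : State a b)
    (x : Occ a) (z : Occ b') : ((1 : Matrix (Occ a) (Occ a) ℂ) ⊗ₖ K).mulVec ψ (x, z) =
      ∑ y, K z y * ψ (x, y) := by
  simp only [Matrix.mulVec, dotProduct, Fintype.sum_prod_type, Matrix.kroneckerMap_apply,
    Matrix.one_apply]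
  rw [Finset.sum_eq_single x] <;> simp +contextual [eq_comm]

/-- A round in which Alice applies a monomial instrument and Bob relabels his modes accordingly. -/
theorem exists_protocol {m n : ℕ} {ι : Type} [Fintype ι] (g : ι → Occ m → Occ n)
    (u : ι → Occ m → ℂ) (hpar : ∀ i, ParityCompatible (g i) (u i))
    (hinj : ∀ i z z', u i z ≠ 0 → u i z' ≠ 0 → g i z = g i z' → z = z')
    (hsum : ∀ x, ∑ i, ∑ z, (if x = g i z then ‖u i z‖ ^ 2 else 0) ≤ 1) :
    ∃ P : LOCC m m n n, ∀ F : State m m → ℝ, (∀ φ, 0 ≤ F φ) → ∀ c : Occ n → ℂ,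
      ∑ i, F (antiState fun z => u i z * c (g i z)) ≤ P.sumOutcomes F (antiState c) := by
  have hbob : ∀ i, ∃ P : LOCC m m m n, ∀ F : State m m → ℝ, (∀ φ, 0 ≤ F φ) → ∀ c : Occ n → ℂ,
      F (antiState fun z => u i z * c (g i z)) ≤
        P.sumOutcomes F ((monomial (g i) (u i) ⊗ₖ 1).mulVec (antiState c)) := by
    intro i
    -- Bob maps `flip (g i z)` to `flip z` for `z` in the support of `u i`. Since `g i` is injective
    -- there, this is a partial isometry.
    have hparBob : ParityCompatible (fun y => flip (g i (flip y)))
        (fun y => if u i (flip y) = 0 then 0 else 1) := by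
      obtain ⟨ε, hε, h⟩ := hpar i
      refine ⟨(-1) ^ n * (-1) ^ m * ε, ?_, fun y hy => ?_⟩
      · rcases neg_one_pow_eq_or_neg n with h1 | h1 <;>
        rcases neg_one_pow_eq_or_neg m with h2 | h2 <;> rcases hε with h3 | h3 <;>
        simp [h1, h2, h3]
      · have hy' : u i (flip y) ≠ 0 := by
          intro h0; simp [h0] at hy
        rw [neg_one_pow_number_flip, h _ hy', neg_one_pow_number_flip]; ring
    have hsumBob : ∀ x, ∑ _j : Unit, ∑ y, (if x = flip (g i (flip y)) then
        ‖(if u i (flip y) = 0 then 0 else 1 : ℂ)‖ ^ 2 else 0) ≤ 1 := by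
      intro x
      simp only [Finset.univ_unique, Finset.sum_singleton]
      by_cases hx : ∃ y, u i (flip y) ≠ 0 ∧ x = flip (g i (flip y))
      · obtain ⟨y, hy, rfl⟩ := hx
        rw [Finset.sum_eq_single y]
        · simp [hy]
        · intro y' _ hne
          by_cases hy' : u i (flip y') = 0
          · simp [hy']
          · rw [if_neg]
            intro h
            exact hne (flip_injective (hinj i _ _ hy' hy (flip_injective h.symm)))
        · simp
      · push Not at hx
        rw [Finset.sum_eq_zero]
        · exact zero_le_one
        · intro y _
          by_cases hy : u i (flip y) = 0
          · simp [hy]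
          · simp [hx y hy]
    obtain ⟨P, hP⟩ := exists_bob (a := m) (ι := Unit) (fun _ y => flip (g i (flip y)))
      (fun _ y => if u i (flip y) = 0 then 0 else 1) (fun _ => hparBob)
      hsumBob (fun _ => LOCC.done) LOCC.done
    refine ⟨P, fun F hF c => le_trans (le_of_eq ?_) (hP F hF _)⟩
    simp only [Finset.univ_unique, Finset.sum_singleton, LOCC.sumOutcomes]
    congr 1
    funext ⟨z, y⟩
    rw [one_kronecker_mulVec_apply]
    simp only [kronecker_one_mulVec_apply, monomial, antiState, Matrix.of_apply, ite_mul,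
      zero_mul, Finset.sum_ite_eq', Finset.mem_univ, if_true,
      flip_injective.eq_iff]
    by_cases hy : u i (flip y) = 0
    · rw [if_pos hy]
      split_ifs with h
      · rw [h, flip_flip] at hy; simp [hy]
      · rfl
    · rw [if_neg hy]
      by_cases hz : u i z = 0
      · simp [hz]
      · have : g i (flip y) = g i z ↔ y = flip z := by
          constructor
          · intro h; rw [← hinj i _ _ hy hz h, flip_flip]
          · intro h; rw [h, flip_flip]
        simp [this]
  choose P hP using hbob
  obtain ⟨fallback, -⟩ := exists_bob (a' := m) (b' := m) (a := m) (m := m) (n := n) (ι := Empty)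
    Empty.elim Empty.elim (fun i => i.elim) (by simp) (fun i => i.elim) LOCC.done
  obtain ⟨Q, hQ⟩ := exists_alice g u hpar hsum P fallback
  exact ⟨Q, fun F hF c => le_trans (Finset.sum_le_sum fun i _ => hP i F hF c) (hQ F hF _)⟩

/-! ### Amplitudes and entropy of e-modes -/

theorem create_apply {n : ℕ} (i : Fin n) (x : Occ n) (f : Occ n → ℂ) :
    ∑ x', create i x x' * f x' =
      if x i = 1 then (-1) ^ (∑ j ∈ Finset.Iio i, (x j : ℕ)) * f (Function.update x i 0) else 0 := by
  split_ifs with hx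
  · rw [Finset.sum_eq_single (Function.update x i 0)]
    · simp only [create, Matrix.of_apply, Function.update_self, Function.update_idem, true_and]
      rw [if_pos (by rw [← hx, Function.update_eq_self])]
      congr 2
      refine Finset.sum_congr rfl fun j hj => ?_
      rw [Function.update_of_ne (Finset.mem_Iio.1 hj).ne]
    · intro x' _ hne
      simp only [create, Matrix.of_apply]
      rw [if_neg, zero_mul]
      rintro ⟨h0, rfl⟩
      exact hne (by rw [Function.update_idem, ← h0, Function.update_eq_self])
    · simp
  · refine Finset.sum_eq_zero fun x' _ => ?_
    simp only [create, Matrix.of_apply]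
    rw [if_neg, zero_mul]
    rintro ⟨_, rfl⟩
    simp at hx

theorem aliceCreate_mulVec_apply {a b : ℕ} (i : Fin a) (ψ : State a b) (x : Occ a) (y : Occ b) :
    (aliceCreate i).mulVec ψ (x, y) =
      if x i = 1 then (-1) ^ (∑ j ∈ Finset.Iio i, (x j : ℕ)) * ψ (Function.update x i 0, y)
      else 0 := by
  rw [aliceCreate, kronecker_one_mulVec_apply, create_apply i x fun x' => ψ (x', y)]

theorem bobCreate_mulVec_apply {a b : ℕ} (i : Fin b) (ψ : State a b) (x : Occ a) (y : Occ b) :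
    (bobCreate i).mulVec ψ (x, y) = (-1) ^ number x *
      if y i = 1 then (-1) ^ (∑ j ∈ Finset.Iio i, (y j : ℕ)) * ψ (x, Function.update y i 0)
      else 0 := by
  rw [← create_apply i y fun y' => ψ (x, y'), bobCreate]
  simp only [Matrix.mulVec, dotProduct, Fintype.sum_prod_type, Matrix.kroneckerMap_apply, parity,
    Matrix.diagonal_apply, Finset.mul_sum]
  rw [Finset.sum_eq_single x]
  · simp [mul_assoc]
  · intro x' _ h; simp [Ne.symm h]
  · simp

/-- The probability of the occupation number `a` of Alice's mode in an e-mode. -/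
def occProb (α β : ℂ) (a : Fin 2) : ℝ := if a = 0 then ‖α‖ ^ 2 else ‖β‖ ^ 2

/-- Squared moduli forget the anticommutation signs. An arbitrary duplicate-free list makes
induction possible: modes not yet created are empty. Hence Alice's and Bob's terms never interfere:
with both `i`-th modes occupied both vanish, and otherwise at most one contributes. -/
theorem norm_sq_prod_mulVec_vacuum {N : ℕ} (α β : ℂ) (l : List (Fin N)) (hl : l.Nodup)
    (x y : Occ N) :
    ‖((l.map fun i => α • bobCreate i + β • aliceCreate i).prod.mulVec (vacuum N N)) (x, y)‖ ^ 2 =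
      ∏ i, if i ∈ l then (if y i = x i + 1 then occProb α β (x i) else 0)
        else (if x i = 0 ∧ y i = 0 then 1 else 0) := by
  induction l generalizing x y with
  | nil =>
    simp only [List.map_nil, List.prod_nil, Matrix.one_mulVec, vacuum, List.not_mem_nil, if_false,
      Finset.prod_ite_zero, Finset.mem_univ, true_imp_iff, Finset.prod_const_one]
    by_cases h : ∀ i, x i = 0 ∧ y i = 0
    · have hx : x = 0 := funext fun i => (h i).1
      have hy : y = 0 := funext fun i => (h i).2
      subst hx hy
      simp
    · rw [if_neg h, Pi.single_eq_of_ne]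
      · simp
      · rintro h'
        obtain ⟨rfl, rfl⟩ := Prod.mk.inj h'
        simp at h
  | cons i l ih =>
    obtain ⟨hi, hl⟩ := List.nodup_cons.1 hl
    rw [List.map_cons, List.prod_cons, ← Matrix.mulVec_mulVec]
    set ψ := ((l.map fun i => α • bobCreate i + β • aliceCreate i).prod.mulVec (vacuum N N))
    have ih := ih hl
    have hval : ((α • bobCreate i + β • aliceCreate i).mulVec ψ) (x, y) =
        α * (bobCreate i).mulVec ψ (x, y) + β * (aliceCreate i).mulVec ψ (x, y) := by
      rw [Matrix.add_mulVec, Matrix.smul_mulVec, Matrix.smul_mulVec]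
      simp
    rw [hval, bobCreate_mulVec_apply, aliceCreate_mulVec_apply]
    have hupd : ∀ x' y' : Occ N, (∀ j, j ≠ i → x' j = x j ∧ y' j = y j) →
        ‖ψ (x', y')‖ ^ 2 = (if x' i = 0 ∧ y' i = 0 then 1 else 0) *
          ∏ j ∈ Finset.univ.erase i,
            if j ∈ i :: l then (if y j = x j + 1 then occProb α β (x j) else 0)
            else (if x j = 0 ∧ y j = 0 then 1 else 0) := by
      intro x' y' h
      rw [ih, ← Finset.mul_prod_erase _ _ (Finset.mem_univ i), if_neg hi]
      congr 1
      refine Finset.prod_congr rfl fun j hj => ?_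
      have hj := (Finset.mem_erase.1 hj).1
      rw [(h j hj).1, (h j hj).2]
      simp [hj]
    have hx := hupd (Function.update x i 0) y fun j hj => by simp [hj]
    have hy := hupd x (Function.update y i 0) fun j hj => by simp [hj]
    rw [← Finset.mul_prod_erase _ _ (Finset.mem_univ i), if_pos List.mem_cons_self]
    set R := ∏ j ∈ Finset.univ.erase i,
            if j ∈ i :: l then (if y j = x j + 1 then occProb α β (x j) else 0)
            else (if x j = 0 ∧ y j = 0 then (1 : ℝ) else 0)
    simp only [Function.update_self, and_true, true_and] at hx hy
    have two : ∀ a : Fin 2, a = 0 ∨ a = 1 := by decide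
    rcases two (x i) with h1 | h1 <;> rcases two (y i) with h2 | h2 <;>
      simp [h1, h2, mul_pow, occProb, show (1 + 1 : Fin 2) = 0 from rfl] at hx hy ⊢
    · simp [hy]
    · simp [hx]
    · simp [hx, hy]

theorem flip_eq_iff {n : ℕ} (x y : Occ n) : y = flip x ↔ ∀ i, y i = x i + 1 := by
  rw [funext_iff]; rfl

theorem norm_sq_eModes (α β : ℂ) (N : ℕ) (x y : Occ N) :
    ‖eModes α β N (x, y)‖ ^ 2 = if y = flip x then ∏ i, occProb α β (x i) else 0 := by
  rw [eModes, List.ofFn_eq_map, norm_sq_prod_mulVec_vacuum α β _ (List.nodup_finRange N)]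
  simp only [List.mem_finRange, if_true, Finset.prod_ite_zero, Finset.mem_univ, true_imp_iff,
    flip_eq_iff]

/-- The Schmidt coefficients of `N` e-modes in the occupation number basis. -/
def eAmplitude (α β : ℂ) (N : ℕ) (x : Occ N) : ℂ := eModes α β N (x, flip x)

theorem eModes_eq_antiState (α β : ℂ) (N : ℕ) :
    eModes α β N = antiState (eAmplitude α β N) := by
  funext ⟨x, y⟩
  simp only [antiState, eAmplitude]
  split_ifs with h
  · rw [h]
  · have := norm_sq_eModes α β N x y
    rw [if_neg h] at this
    simpa using this

theorem norm_sq_eAmplitude (α β : ℂ) (N : ℕ) (x : Occ N) :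
    ‖eAmplitude α β N x‖ ^ 2 = ∏ i, occProb α β (x i) := by
  rw [eAmplitude, norm_sq_eModes, if_pos rfl]

theorem norm_sq_eAmplitude_perfect (k : ℕ) (x : Occ k) :
    ‖eAmplitude ((1 / Real.sqrt 2 : ℝ) : ℂ) ((1 / Real.sqrt 2 : ℝ) : ℂ) k x‖ ^ 2 =
      ((2 : ℝ) ^ k)⁻¹ := by
  rw [norm_sq_eAmplitude]
  have : ∀ a : Fin 2,
      occProb ((1 / Real.sqrt 2 : ℝ) : ℂ) ((1 / Real.sqrt 2 : ℝ) : ℂ) a = 2⁻¹ := by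
    intro a
    rw [occProb, ite_self, Complex.norm_real, Real.norm_eq_abs, sq_abs, div_pow]
    simp
  simp only [this, Finset.prod_const, Finset.card_univ, Fintype.card_fin, inv_pow]

/-- The reduced state is diagonal. Its eigenvalues are compared with the diagonal entries as
multisets, through the roots of the characteristic polynomial, so their ordering is irrelevant. -/
theorem entanglementEntropy_eModes_one (α β : ℂ) :
    entanglementEntropy (eModes α β 1) =
      (∑ a, Real.negMulLog (occProb α β a)) / Real.log 2 := by
  have hdiag : reducedState (eModes α β 1) =
      Matrix.diagonal fun x : Occ 1 => ((occProb α β (x 0) : ℝ) : ℂ) := by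
    ext x x'
    simp only [reducedState, Matrix.of_apply, Matrix.diagonal_apply, eModes_eq_antiState, antiState]
    rw [Finset.sum_eq_single (flip x)]
    · split_ifs with h1 h2 h2
      · subst h2
        have := norm_sq_eAmplitude α β 1 x
        simp only [Finset.univ_unique, Fin.default_eq_zero, Fin.isValue,
          Finset.prod_singleton] at this
        rw [Complex.star_def, Complex.mul_conj', ← this]
        norm_cast
      · simp
        exact absurd (flip_injective ‹_›) h2
      all_goals simp_all
    · intro y _ hy; simp [hy]
    · simp
  have hroots := (reducedState_isHermitian (eModes α β 1)).roots_charpoly_eq_eigenvalues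
  have hroots' : (reducedState (eModes α β 1)).charpoly.roots =
      Multiset.map (fun x : Occ 1 => ((occProb α β (x 0) : ℝ) : ℂ)) Finset.univ.val := by
    have h := Polynomial.roots_multiset_prod_X_sub_C
      (Multiset.map (fun x : Occ 1 => ((occProb α β (x 0) : ℝ) : ℂ)) Finset.univ.val)
    rw [Multiset.map_map] at h
    rw [hdiag, Matrix.charpoly_diagonal]
    exact h
  rw [hroots'] at hroots
  have hsum := congrArg (fun s => (s.map fun a : ℂ => Real.negMulLog a.re).sum) hroots
  simp only [Multiset.map_map, Function.comp_def, Complex.ofReal_re] at hsum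
  rw [entanglementEntropy, vonNeumannEntropy, ← Finset.sum_div]
  congr 1
  refine Eq.trans hsum.symm ?_
  exact Equiv.sum_comp (Equiv.funUnique (Fin 1) (Fin 2)) fun a => Real.negMulLog (occProb α β a)

/-! ### Independent draws and typical configurations -/

theorem sum_occ_succ {N : ℕ} (f : Occ (N + 1) → ℝ) :
    ∑ x, f x = ∑ a : Fin 2, ∑ y : Occ N, f (Fin.cons a y) := by
  rw [← (Fin.consEquiv fun _ => Fin 2).sum_comp, Fintype.sum_prod_type]
  rfl

theorem sum_prod_eq_one {p : Fin 2 → ℝ} (hp : ∑ a, p a = 1) (N : ℕ) :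
    ∑ x : Occ N, ∏ i, p (x i) = 1 := by
  rw [← Fintype.sum_pow, hp, one_pow]

theorem sum_prod_mul_sum {p g : Fin 2 → ℝ} (hp : ∑ a, p a = 1) (hg : ∑ a, p a * g a = 0) (N : ℕ) :
    ∑ x : Occ N, (∏ i, p (x i)) * ∑ i, g (x i) = 0 := by
  induction N with
  | zero => simp
  | succ N ih =>
    simp only [sum_occ_succ, Fin.prod_univ_succ (M := ℝ), Fin.sum_univ_succ (n := N),
      Fin.cons_zero, Fin.cons_succ]
    have : ∀ a : Fin 2, ∑ y : Occ N, p a * (∏ i, p (y i)) * (g a + ∑ i, g (y i)) = p a * g a := by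
      intro a
      have : ∀ y : Occ N, p a * (∏ i, p (y i)) * (g a + ∑ i, g (y i)) =
          p a * g a * (∏ i, p (y i)) + p a * ((∏ i, p (y i)) * ∑ i, g (y i)) := fun y => by ring
      simp only [this, Finset.sum_add_distrib, ← Finset.mul_sum, ih, sum_prod_eq_one hp]
      ring
    simp only [this, hg]

/-- The variance of a sum of independent identically distributed centred variables. -/
theorem sum_prod_mul_sum_sq {p g : Fin 2 → ℝ} (hp : ∑ a, p a = 1) (hg : ∑ a, p a * g a = 0)
    (N : ℕ) :
    ∑ x : Occ N, (∏ i, p (x i)) * (∑ i, g (x i)) ^ 2 = N * ∑ a, p a * g a ^ 2 := by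
  induction N with
  | zero => simp
  | succ N ih =>
    simp only [sum_occ_succ, Fin.prod_univ_succ (M := ℝ), Fin.sum_univ_succ (n := N),
      Fin.cons_zero, Fin.cons_succ]
    have : ∀ a : Fin 2, ∑ y : Occ N, p a * (∏ i, p (y i)) * (g a + ∑ i, g (y i)) ^ 2 =
        p a * g a ^ 2 + p a * (N * ∑ a, p a * g a ^ 2) := by
      intro a
      have : ∀ y : Occ N, p a * (∏ i, p (y i)) * (g a + ∑ i, g (y i)) ^ 2 =
          p a * g a ^ 2 * (∏ i, p (y i)) + 2 * p a * g a * ((∏ i, p (y i)) * ∑ i, g (y i)) +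
          p a * ((∏ i, p (y i)) * (∑ i, g (y i)) ^ 2) := fun y => by ring
      simp only [this, Finset.sum_add_distrib, ← Finset.mul_sum, ih, sum_prod_eq_one hp,
        sum_prod_mul_sum hp hg]
      ring
    simp only [this]
    rw [Finset.sum_add_distrib, ← Finset.sum_mul, hp]
    push_cast
    ring

/-- The Shannon entropy of a distribution on `Fin 2`, in nats. -/
def entropyNats (p : Fin 2 → ℝ) : ℝ := ∑ a, Real.negMulLog (p a)

/-- The weakly typical configurations. -/
def typical (p : Fin 2 → ℝ) (δ : ℝ) (N : ℕ) : Finset (Occ N) :=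
  open Classical in Finset.univ.filter fun x =>
    0 < ∏ i, p (x i) ∧ |Real.log (∏ i, p (x i)) + N * entropyNats p| ≤ δ * N

theorem mem_typical {p : Fin 2 → ℝ} {δ : ℝ} {N : ℕ} {x : Occ N} : x ∈ typical p δ N ↔
    0 < ∏ i, p (x i) ∧ |Real.log (∏ i, p (x i)) + N * entropyNats p| ≤ δ * N := by
  simp [typical]

theorem le_prod_of_mem_typical {p : Fin 2 → ℝ} {δ : ℝ} {N : ℕ} {x : Occ N}
    (hx : x ∈ typical p δ N) : Real.exp (-(N * (entropyNats p + δ))) ≤ ∏ i, p (x i) := by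
  obtain ⟨h0, h⟩ := mem_typical.1 hx
  rw [← Real.le_log_iff_exp_le h0]
  linarith [(abs_le.1 h).1]

theorem prod_le_of_mem_typical {p : Fin 2 → ℝ} {δ : ℝ} {N : ℕ} {x : Occ N}
    (hx : x ∈ typical p δ N) : ∏ i, p (x i) ≤ Real.exp (-(N * (entropyNats p - δ))) := by
  obtain ⟨h0, h⟩ := mem_typical.1 hx
  rw [← Real.log_le_iff_le_exp h0]
  linarith [(abs_le.1 h).2]

theorem card_typical_le {p : Fin 2 → ℝ} (hp0 : ∀ a, 0 ≤ p a) (hp : ∑ a, p a = 1) (δ : ℝ) (N : ℕ) :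
    ((typical p δ N).card : ℝ) ≤ Real.exp (N * (entropyNats p + δ)) := by
  have h : (typical p δ N).card * Real.exp (-(N * (entropyNats p + δ))) ≤ 1 := by
    rw [← sum_prod_eq_one hp N, ← nsmul_eq_mul, ← Finset.sum_const]
    exact (Finset.sum_le_sum fun x hx => le_prod_of_mem_typical hx).trans
      (Finset.sum_le_sum_of_subset_of_nonneg (Finset.subset_univ _)
        fun x _ _ => Finset.prod_nonneg fun i _ => hp0 _)
  rwa [Real.exp_neg, mul_inv_le_iff₀ (Real.exp_pos _), one_mul] at h

/-- The asymptotic equipartition property. -/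
theorem exists_sum_typical_ge {p : Fin 2 → ℝ} (hp0 : ∀ a, 0 ≤ p a) (hp : ∑ a, p a = 1) {δ η : ℝ}
    (hδ : 0 < δ) (hη : 0 < η) :
    ∃ N₀ : ℕ, ∀ N, N₀ ≤ N → 1 - η ≤ ∑ x ∈ typical p δ N, ∏ i, p (x i) := by
  -- The centred self-information; Chebyshev's inequality for its sum gives the result.
  set g : Fin 2 → ℝ := fun a => -Real.log (p a) - entropyNats p with hg
  have hg0 : ∑ a, p a * g a = 0 := by
    simp only [hg, mul_sub, Finset.sum_sub_distrib, ← Finset.sum_mul, hp, one_mul]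
    rw [sub_eq_zero, entropyNats]
    exact Finset.sum_congr rfl fun a _ => by rw [Real.negMulLog]; ring
  set V := ∑ a, p a * g a ^ 2
  obtain ⟨N₀, hN₀⟩ := exists_nat_gt (V / (δ ^ 2 * η))
  refine ⟨N₀ + 1, fun N hN => ?_⟩
  have hNpos : (0 : ℝ) < N := by exact_mod_cast (by omega : 0 < N)
  have hN' : V / (δ ^ 2 * η) < N := hN₀.trans_le (by exact_mod_cast (by omega : N₀ ≤ N))
  have hP0 : ∀ x : Occ N, 0 ≤ ∏ i, p (x i) := fun x => Finset.prod_nonneg fun i _ => hp0 _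
  -- Configurations of probability zero count as atypical, but contribute nothing to either side.
  have hbound : ∀ x : Occ N, x ∉ typical p δ N →
      (δ * N) ^ 2 * ∏ i, p (x i) ≤ (∏ i, p (x i)) * (∑ i, g (x i)) ^ 2 := by
    intro x hx
    rcases (hP0 x).eq_or_lt with h0 | h0
    · simp [← h0]
    · rw [mem_typical, not_and, not_le] at hx
      have hlog : Real.log (∏ i, p (x i)) + N * entropyNats p = -∑ i, g (x i) := by
        rw [Real.log_prod fun i _ h => h0.ne' (Finset.prod_eq_zero (Finset.mem_univ i) h)]
        simp [hg, Finset.sum_sub_distrib, add_comm]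
      have h := hx h0
      rw [hlog, abs_neg] at h
      rw [mul_comm]
      refine mul_le_mul_of_nonneg_left ?_ h0.le
      rw [← sq_abs (∑ i, g (x i))]
      exact pow_le_pow_left₀ (by positivity) h.le 2
  have hsum : (δ * N) ^ 2 * ∑ x ∈ (typical p δ N)ᶜ, ∏ i, p (x i) ≤ N * V := by
    rw [← sum_prod_mul_sum_sq hp hg0 N, Finset.mul_sum]
    refine (Finset.sum_le_sum fun x hx => hbound x (Finset.mem_compl.1 hx)).trans ?_
    exact Finset.sum_le_sum_of_subset_of_nonneg (Finset.subset_univ _)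
      fun x _ _ => mul_nonneg (hP0 x) (sq_nonneg _)
  have htot := Finset.sum_add_sum_compl (typical p δ N) fun x => ∏ i, p (x i)
  rw [sum_prod_eq_one hp] at htot
  rw [div_lt_iff₀ (by positivity)] at hN'
  have : ∑ x ∈ (typical p δ N)ᶜ, ∏ i, p (x i) ≤ η := by
    by_contra! hlt
    have h1 : (δ * N) ^ 2 * η < N * V := (mul_lt_mul_of_pos_left hlt (by positivity)).trans_le hsum
    have h2 : (N : ℝ) * V < N * (N * (δ ^ 2 * η)) := mul_lt_mul_of_pos_left hN' hNpos
    nlinarith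
  linarith

/-! ### Dilution -/

theorem neg_one_pow_number_cons {n : ℕ} (b : Fin 2) (t : Occ n) :
    (-1 : ℂ) ^ number (Fin.cons b t : Occ (n + 1)) = (-1) ^ (b : ℕ) * (-1) ^ number t := by
  rw [number, Fin.sum_univ_succ, pow_add]
  simp [number]

/-- `k` modes suffice to label `T`; one further mode is filled or left empty to correct the parity.
-/
theorem exists_parity_embedding {N k : ℕ} (T : Finset (Occ N)) (hT : T.card ≤ 2 ^ k) :
    ∃ j : Occ N → Occ (k + 1), Set.InjOn j T ∧ ∀ x, (-1 : ℂ) ^ number (j x) = (-1) ^ number x := by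
  have hcard : Fintype.card T ≤ Fintype.card (Occ k) := by simpa using hT
  obtain ⟨h⟩ := Function.Embedding.nonempty_of_card_le hcard
  classical
  let t : Occ N → Occ k := fun x => if hx : x ∈ T then h ⟨x, hx⟩ else 0
  have hb : ∀ x, ∃ b : Fin 2, (-1 : ℂ) ^ (b : ℕ) * (-1) ^ number (t x) = (-1) ^ number x := by
    intro x
    rcases neg_one_pow_eq_or_neg (number (t x)) with h1 | h1 <;>
      rcases neg_one_pow_eq_or_neg (number x) with h2 | h2
    · exact ⟨0, by simp [h1, h2]⟩
    · exact ⟨1, by simp [h1, h2]⟩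
    · exact ⟨1, by simp [h1, h2]⟩
    · exact ⟨0, by simp [h1, h2]⟩
  choose b hb using hb
  refine ⟨fun x => Fin.cons (b x) (t x), fun x hx y hy hxy => ?_, fun x => ?_⟩
  · have := (Fin.cons_inj.1 hxy).2
    simp only [t, dif_pos (Finset.mem_coe.1 hx), dif_pos (Finset.mem_coe.1 hy)] at this
    exact congrArg Subtype.val (h.injective this)
  · rw [neg_one_pow_number_cons, hb]

/-- A maximally entangled state with `2 ^ (k + 1)` Schmidt vectors yields any state, up to the
weight outside a set of at most `2 ^ k` configurations. -/
theorem exists_dilution_protocol {N k : ℕ} {c : Occ N → ℂ} (hc : ∑ x, ‖c x‖ ^ 2 = 1)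
    {d : Occ (k + 1) → ℂ} (hd : ∀ z, ‖d z‖ ^ 2 = ((2 : ℝ) ^ (k + 1))⁻¹)
    (T : Finset (Occ N)) (hT : T.card ≤ 2 ^ k) :
    ∃ P : LOCC N N (k + 1) (k + 1),
      (∑ x ∈ T, ‖c x‖ ^ 2) ^ 2 ≤ P.fidelity (antiState d) (antiState c) := by
  classical
  obtain ⟨j, hj, hjpar⟩ := exists_parity_embedding T hT
  set r : ℝ := Real.sqrt ((2 : ℝ) ^ (k + 1))⁻¹ with hr
  have hr2 : r ^ 2 = ((2 : ℝ) ^ (k + 1))⁻¹ := Real.sq_sqrt (by positivity)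
  have hr0 : 0 < r := Real.sqrt_pos.2 (by positivity)
  have hdn : ∀ z, ‖d z‖ = r := fun z => by
    rw [hr, ← hd z, Real.sqrt_sq (norm_nonneg _)]
  have hd0 : ∀ z, d z ≠ 0 := fun z => norm_pos_iff.1 (by rw [hdn z]; exact hr0)
  -- Dividing by `d` removes its phases, so every outcome leaves exactly `r * c x` on `T`.
  let u : Occ (k + 1) → Occ N → ℂ := fun s x => if x ∈ T then c x * r / d (j x + s) else 0
  have hun : ∀ s x, ‖u s x‖ ^ 2 = if x ∈ T then ‖c x‖ ^ 2 else 0 := by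
    intro s x
    simp only [u]
    split_ifs with h
    · rw [norm_div, norm_mul, hdn, Complex.norm_real, Real.norm_of_nonneg hr0.le,
        mul_div_cancel_right₀ _ hr0.ne']
    · simp
  have huT : ∀ s x, u s x ≠ 0 → x ∈ T := by
    intro s x h
    by_contra h'
    exact h (if_neg h')
  obtain ⟨P, hP⟩ := exists_protocol (fun (s : Occ (k + 1)) x => j x + s) u
    (fun s => ⟨(-1) ^ number s, neg_one_pow_eq_or_neg _, fun x _ => by
      rw [neg_one_pow_number_add, hjpar, mul_comm]⟩)
    (fun s x y hx hy h => hj (huT s x hx) (huT s y hy) (add_right_cancel h))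
    -- For given `z` and `x` exactly one shift `s` satisfies `z = j x + s`, so the sum is the weight
    -- of `T`.
    (fun z => by
      rw [Finset.sum_comm, ← hc]
      refine Finset.sum_le_sum fun x _ => ?_
      rw [Finset.sum_eq_single (z - j x)]
      · rw [if_pos (by abel), hun]
        split_ifs
        · exact le_rfl
        · positivity
      · intro s _ hs
        rw [if_neg]
        rintro rfl
        exact hs (by abel)
      · simp)
  refine ⟨P, le_trans (le_of_eq ?_) (hP (fun φ => ‖braket (antiState c) φ‖ ^ 2)
    (fun φ => by positivity) d)⟩
  have hbr : ∀ s, braket (antiState c) (antiState fun x => u s x * d (j x + s)) =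
      ((r * ∑ x ∈ T, ‖c x‖ ^ 2 : ℝ) : ℂ) := by
    intro s
    rw [braket_antiState, ← Finset.sum_subset (Finset.subset_univ T), Finset.mul_sum,
      Complex.ofReal_sum]
    · refine Finset.sum_congr rfl fun x hx => ?_
      simp only [u, if_pos hx]
      rw [div_mul_cancel₀ _ (hd0 _), ← mul_assoc, Complex.star_def, Complex.conj_mul']
      push_cast
      ring
    · intro x _ hx
      simp [u, hx]
  simp only [hbr, Complex.norm_real, Real.norm_eq_abs, sq_abs, mul_pow, hr2, Finset.sum_const,
    Finset.card_univ, nsmul_eq_mul]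
  rw [← mul_assoc]
  simp

theorem occProb_nonneg (α β : ℂ) (a : Fin 2) : 0 ≤ occProb α β a := by
  unfold occProb; split_ifs <;> positivity

theorem sum_occProb {α β : ℂ} (h : ‖α‖ ^ 2 + ‖β‖ ^ 2 = 1) : ∑ a, occProb α β a = 1 := by
  simpa [Fin.sum_univ_two, occProb] using h

theorem sum_norm_sq_eAmplitude {α β : ℂ} (h : ‖α‖ ^ 2 + ‖β‖ ^ 2 = 1) (N : ℕ) :
    ∑ x, ‖eAmplitude α β N x‖ ^ 2 = 1 := by
  simp only [norm_sq_eAmplitude, sum_prod_eq_one (sum_occProb h)]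

theorem entropyNats_nonneg {p : Fin 2 → ℝ} (hp0 : ∀ a, 0 ≤ p a) (hp : ∑ a, p a = 1) :
    0 ≤ entropyNats p :=
  Finset.sum_nonneg fun a _ => Real.negMulLog_nonneg (hp0 a)
    (hp ▸ Finset.single_le_sum (fun b _ => hp0 b) (Finset.mem_univ a))

theorem dilution {α β : ℂ} (hαβ : ‖α‖ ^ 2 + ‖β‖ ^ 2 = 1) {ε : ℝ} (hε : 0 < ε) :
    ∃ N₀ : ℕ, ∀ N : ℕ, N₀ ≤ N →
      ∃ k : ℕ, |(k : ℝ) - N * entanglementEntropy (eModes α β 1)| ≤ ε * N ∧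
        ∃ P : LOCC N N k k, 1 - ε ≤ P.fidelity (perfectEModes k) (eModes α β N) := by
  have hlog : 0 < Real.log 2 := Real.log_pos one_lt_two
  have hp0 := occProb_nonneg α β
  have hp := sum_occProb hαβ
  set p := occProb α β with hpdef
  set δ := ε * Real.log 2 / 2 with hδ
  have hδ0 : 0 < δ := by positivity
  obtain ⟨N₁, hN₁⟩ := exists_sum_typical_ge hp0 hp hδ0 (half_pos hε)
  obtain ⟨N₂, hN₂⟩ := exists_nat_gt (4 / ε)
  refine ⟨max N₁ N₂, fun N hN => ?_⟩
  have hN4 : 4 < ε * N := by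
    have : 4 / ε < N := hN₂.trans_le (by exact_mod_cast le_of_max_le_right hN)
    rwa [div_lt_iff₀' hε] at this
  have hH := entropyNats_nonneg hp0 hp
  set H := entropyNats p with hHdef
  have hS : entanglementEntropy (eModes α β 1) = H / Real.log 2 :=
    entanglementEntropy_eModes_one α β
  -- Base-2 logarithm of the bound on the typical set. With `δ = ε log 2 / 2` it exceeds N times the
  -- entropy by `ε N / 2`; the other half absorbs the ceiling and the parity mode, as `4 < ε N`.
  set t := N * (H + δ) / Real.log 2 with ht
  have ht0 : 0 ≤ t := by positivity
  refine ⟨⌈t⌉₊ + 1, ?_, ?_⟩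
  · have h1 := Nat.le_ceil t
    have h2 := Nat.ceil_lt_add_one ht0
    have h3 : t = N * (H / Real.log 2) + ε * N / 2 := by
      rw [ht, hδ]; field_simp
    rw [hS]
    push_cast
    rw [abs_le]
    constructor <;> linarith
  · have hcard : (typical p δ N).card ≤ 2 ^ ⌈t⌉₊ := by
      have h1 : ((typical p δ N).card : ℝ) ≤ (2 : ℝ) ^ ⌈t⌉₊ := by
        refine (card_typical_le hp0 hp δ N).trans ?_
        rw [← Real.rpow_natCast, Real.rpow_def_of_pos two_pos, Real.exp_le_exp, mul_comm (Real.log 2),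
          ← div_le_iff₀ hlog]
        exact Nat.le_ceil t
      exact_mod_cast h1
    obtain ⟨P, hP⟩ := exists_dilution_protocol (sum_norm_sq_eAmplitude hαβ N)
      (norm_sq_eAmplitude_perfect (⌈t⌉₊ + 1)) _ hcard
    refine ⟨P, ?_⟩
    rw [perfectEModes, eModes_eq_antiState, eModes_eq_antiState α β]
    refine le_trans ?_ hP
    simp only [norm_sq_eAmplitude]
    -- For a typical weight W ≥ 1 - ε/2, W² ≥ 2W - 1 ≥ 1 - ε.
    nlinarith [hN₁ N (le_of_max_le_left hN), sq_nonneg (∑ x ∈ typical p δ N, ∏ i, p (x i) - 1)]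

/-! ### Weight classes and concentration -/

/-- The configurations with the same number of fermions as `x`. -/
def weightClass {N : ℕ} (x : Occ N) : Finset (Occ N) :=
  Finset.univ.filter fun y => number y = number x

/-- A cyclic shift inside each weight class. -/
theorem exists_cyclic_shift (N : ℕ) : ∃ φ : ℕ → Occ N → Occ N,
    (∀ l s, number (φ l s) = number s) ∧ (∀ l, Function.Injective (φ l)) ∧
    ∀ M s, M ≤ (weightClass s).card → ∀ l l', l < M → l' < M → φ l s = φ l' s → l = l' := by
  choose σ hσ _ using fun w : ℕ =>
    Finset.exists_cycleOn (Finset.univ.filter fun y : Occ N => number y = w)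
  refine ⟨fun l s => (σ (number s) ^ l) s, fun l s => ?_, fun l s s' h => ?_,
    fun M s hM l l' hl hl' h => ?_⟩
  · have h := ((hσ (number s)).1.perm_pow l).mapsTo (x := s) (by simp)
    simpa using h
  · have hnum : ∀ s, number ((σ (number s) ^ l) s) = number s := fun s => by
      have h := ((hσ (number s)).1.perm_pow l).mapsTo (x := s) (by simp)
      simpa using h
    have h' : number s = number s' := by rw [← hnum s, ← hnum s']; exact congrArg number h
    simp only [h'] at h
    exact (σ (number s') ^ l).injective h
  · have hs : s ∈ Finset.univ.filter fun y : Occ N => number y = number s := by simp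
    have h1 := ((hσ (number s)).pow_apply_eq_pow_apply hs).1 h
    exact h1.eq_of_lt_of_lt (hl.trans_le hM) (hl'.trans_le hM)

theorem eq_of_tail_eq {k : ℕ} {z z' : Occ (k + 1)} (ht : Fin.tail z = Fin.tail z')
    (hpar : Even (number z) ↔ Even (number z')) : z = z' := by
  rw [← Fin.cons_self_tail z, ← Fin.cons_self_tail z', ht] at hpar ⊢
  simp only [number, Fin.sum_univ_succ, Fin.cons_zero, Fin.cons_succ, Nat.even_add] at hpar
  congr 1
  have : ∀ a b : Fin 2, (Even (a : ℕ) ↔ Even (b : ℕ)) → a = b := by decide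
  exact this _ _ (by tauto)

/-- Within one parity sector the first mode is determined by the others, so `Fin.tail` is injective.
-/
theorem card_filter_parity_le {k : ℕ} (p : Occ (k + 1) → Prop) [DecidablePred p]
    (hp : ∀ z z', p z → p z' → (Even (number z) ↔ Even (number z'))) :
    (Finset.univ.filter p).card ≤ 2 ^ k := by
  have h := Finset.card_le_card_of_injOn (s := Finset.univ.filter p) (t := Finset.univ)
    (Fin.tail : Occ (k + 1) → Occ k) (by simp) (fun z hz z' hz' h => by
      simp at hz hz'
      exact eq_of_tail_eq h (hp z z' hz hz'))
  simpa using h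

theorem neg_one_pow_eq_of_even_iff {m n : ℕ} (h : Even m ↔ Even n) :
    (-1 : ℂ) ^ m = (-1) ^ n := by
  by_cases hn : Even n
  · rw [hn.neg_one_pow, (h.2 hn).neg_one_pow]
  · rw [(Nat.not_even_iff_odd.1 hn).neg_one_pow,
      (Nat.not_even_iff_odd.1 (mt h.1 hn)).neg_one_pow]

theorem sum_ite_le_of_injective {ι κ : Type} [Fintype ι] [DecidableEq κ] {f : ι → κ}
    (hf : Function.Injective f) (x : κ) : ∑ s, (if x = f s then (1 : ℝ) else 0) ≤ 1 := by
  by_cases h : ∃ s, x = f s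
  · obtain ⟨s, rfl⟩ := h
    rw [Finset.sum_eq_single s]
    · simp
    · intro s' _ hne
      rw [if_neg fun h => hne (hf h).symm]
    · simp
  · push Not at h
    simp [h]

/-- The configurations whose weight class has at least `M` elements. -/
def largeClass (N M : ℕ) : Finset (Occ N) := Finset.univ.filter fun x => M ≤ (weightClass x).card

/-- Concentration from a state whose Schmidt coefficients depend only on the number of fermions: each
outcome selects a block of equiprobable even configurations and one of odd configurations. -/
theorem exists_concentration_protocol {N k : ℕ} {c : Occ N → ℂ} (hc0 : ∀ x, c x ≠ 0)
    (hcn : ∀ x y, number x = number y → ‖c x‖ ^ 2 = ‖c y‖ ^ 2)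
    {d : Occ (k + 1) → ℂ} (hd : ∀ z, ‖d z‖ ^ 2 = ((2 : ℝ) ^ (k + 1))⁻¹) :
    ∃ P : LOCC (k + 1) (k + 1) N N,
      2 * min (∑ x ∈ largeClass N (2 ^ k) with Even (number x), ‖c x‖ ^ 2)
        (∑ x ∈ largeClass N (2 ^ k) with ¬ Even (number x), ‖c x‖ ^ 2) ≤
      P.successProb (antiState c) (antiState d) := by
  classical
  set E := (largeClass N (2 ^ k)).filter fun x => Even (number x) with hE
  set O := (largeClass N (2 ^ k)).filter fun x => ¬ Even (number x) with hO
  set We := ∑ x ∈ E, ‖c x‖ ^ 2 with hWe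
  set Wo := ∑ x ∈ O, ‖c x‖ ^ 2 with hWo
  have hWe0 : 0 ≤ We := Finset.sum_nonneg fun _ _ => by positivity
  have hWo0 : 0 ≤ Wo := Finset.sum_nonneg fun _ _ => by positivity
  set D := max We Wo with hD
  have hD0 : 0 ≤ D := hWe0.trans (le_max_left _ _)
  have hM : (0 : ℝ) < 2 ^ k := by positivity
  obtain ⟨φ, hφn, hφi, hφl⟩ := exists_cyclic_shift N
  let e : Occ (k + 1) → ℕ := fun z => Fintype.equivFin (Occ k) (Fin.tail z)
  have he : ∀ z, e z < 2 ^ k := fun z => by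
    have := (Fintype.equivFin (Occ k) (Fin.tail z)).2
    simpa using this
  have heinj : ∀ z z', e z = e z' → Fin.tail z = Fin.tail z' := fun z z' h =>
    (Fintype.equivFin (Occ k)).injective (Fin.ext h)
  -- The parity of `z` chooses the even or odd seed and its tail the shift. Shifting keeps the
  -- weight class; for classes of size at least `2 ^ k` the shifted seeds are distinct.
  let g : E × O → Occ (k + 1) → Occ N := fun i z =>
    φ (e z) (if Even (number z) then i.1 else i.2)
  have hEe : ∀ s : E, Even (number (s : Occ N)) := fun s => (Finset.mem_filter.1 s.2).2
  have hOo : ∀ s : O, ¬ Even (number (s : Occ N)) := fun s => (Finset.mem_filter.1 s.2).2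
  have hEl : ∀ s : E, 2 ^ k ≤ (weightClass (s : Occ N)).card := fun s =>
    (Finset.mem_filter.1 (Finset.mem_filter.1 s.2).1).2
  have hOl : ∀ s : O, 2 ^ k ≤ (weightClass (s : Occ N)).card := fun s =>
    (Finset.mem_filter.1 (Finset.mem_filter.1 s.2).1).2
  have hgpar : ∀ i z, Even (number (g i z)) ↔ Even (number z) := by
    intro i z
    simp only [g, hφn]
    split_ifs with h
    · simp [h, hEe]
    · simp only [h, iff_false]; exact hOo _
  -- `a i ^ 2` is the probability of outcome `i`. The sum over all pairs of seeds is 2 We Wo /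
  -- max(We, Wo) = 2 min(We, Wo).
  let a : E × O → ℝ := fun i => Real.sqrt (2 * (‖c i.1‖ ^ 2 * ‖c i.2‖ ^ 2 / D))
  have ha : ∀ i, a i ^ 2 = 2 * (‖c i.1‖ ^ 2 * ‖c i.2‖ ^ 2 / D) := fun i =>
    Real.sq_sqrt (by positivity)
  let u : E × O → Occ (k + 1) → ℂ := fun i z => a i * d z / c (g i z)
  have hu : ∀ i z, ‖u i z‖ ^ 2 =
      if Even (number z) then ‖c i.2‖ ^ 2 / (D * 2 ^ k) else ‖c i.1‖ ^ 2 / (D * 2 ^ k) := by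
    intro i z
    have h1 : ‖c i.1‖ ≠ 0 := norm_ne_zero_iff.2 (hc0 _)
    have h2 : ‖c i.2‖ ≠ 0 := norm_ne_zero_iff.2 (hc0 _)
    simp only [u]
    rw [norm_div, norm_mul, div_pow, mul_pow, hd, Complex.norm_real, Real.norm_eq_abs, sq_abs, ha,
      hcn (g i z) _ (hφn _ _)]
    split_ifs <;> field_simp <;> ring
  obtain ⟨P, hP⟩ := exists_protocol g u
    (fun i => ⟨1, Or.inl rfl, fun z _ => by
      rw [one_mul]; exact neg_one_pow_eq_of_even_iff (hgpar i z)⟩)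
    (fun i z z' _ _ h => by
      have hpar : Even (number z) ↔ Even (number z') := by
        rw [← hgpar i z, ← hgpar i z', h]
      refine eq_of_tail_eq (heinj _ _ ?_) hpar
      simp only [g, ← hpar] at h
      split_ifs at h with h'
      · exact hφl _ _ (hEl i.1) _ _ (he z) (he z') h
      · exact hφl _ _ (hOl i.2) _ _ (he z) (he z') h)
    (fun x => by
      rw [Finset.sum_comm]
      -- For even `x`, each even `z` meets at most one even seed, and summing over odd seeds gives
      -- `Wo / (D * 2 ^ k)`. There are at most `2 ^ k` such `z`, so the total is at most `Wo / D ≤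
      -- 1`; odd `x` is symmetric.
      have hdiv : ∀ W, W / (D * 2 ^ k) * (2 : ℝ) ^ k = W / D := fun W => by
        rw [← div_div, div_mul_cancel₀ _ hM.ne']
      have hbound : ∀ W : ℝ, 0 ≤ W → W ≤ D → (∀ z, ∑ i, (if x = g i z then ‖u i z‖ ^ 2 else 0) ≤
          if (Even (number z) ↔ Even (number x)) then W / (D * 2 ^ k) else 0) →
          ∑ z, ∑ i, (if x = g i z then ‖u i z‖ ^ 2 else 0) ≤ 1 := by
        intro W hW0 hW hz
        refine (Finset.sum_le_sum fun z _ => hz z).trans ?_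
        rw [← Finset.sum_filter, Finset.sum_const, nsmul_eq_mul]
        have hcard := card_filter_parity_le (k := k)
          (fun z => (Even (number z) ↔ Even (number x))) (fun z z' h h' => h.trans h'.symm)
        have hcard' : ((Finset.univ.filter fun z : Occ (k + 1) =>
          (Even (number z) ↔ Even (number x))).card : ℝ) ≤ 2 ^ k := by exact_mod_cast hcard
        refine (mul_le_mul_of_nonneg_right hcard' (by positivity)).trans ?_
        rw [mul_comm, hdiv]
        exact div_le_one_of_le₀ hW hD0
      have hzero : ∀ z, ¬ (Even (number z) ↔ Even (number x)) →
          ∑ i, (if x = g i z then ‖u i z‖ ^ 2 else 0) = 0 := fun z hz =>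
        Finset.sum_eq_zero fun i _ => if_neg fun h => hz (by rw [h, hgpar])
      by_cases hx : Even (number x)
      · refine hbound Wo hWo0 (le_max_right _ _) fun z => ?_
        split_ifs with hz
        · have hz' := hz.2 hx
          simp only [g, hu, if_pos hz', Fintype.sum_prod_type]
          have : ∀ (s : E), ∑ s' : O, (if x = φ (e z) s then ‖c s'‖ ^ 2 / (D * 2 ^ k) else 0) =
              (if x = φ (e z) s then 1 else 0) * (Wo / (D * 2 ^ k)) := by
            intro s
            split_ifs
            · rw [one_mul, ← Finset.sum_div, hWo, ← Finset.sum_coe_sort O]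
            · simp
          simp only [this, ← Finset.sum_mul]
          exact mul_le_of_le_one_left (by positivity)
            (sum_ite_le_of_injective ((hφi _).comp Subtype.val_injective) x)
        · exact (hzero z hz).le
      · refine hbound We hWe0 (le_max_left _ _) fun z => ?_
        split_ifs with hz
        · have hz' := mt hz.1 hx
          simp only [g, hu, if_neg hz', Fintype.sum_prod_type_right]
          have : ∀ (s : O), ∑ s' : E, (if x = φ (e z) s then ‖c s'‖ ^ 2 / (D * 2 ^ k) else 0) =
              (if x = φ (e z) s then 1 else 0) * (We / (D * 2 ^ k)) := by
            intro s
            split_ifs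
            · rw [one_mul, ← Finset.sum_div, hWe, ← Finset.sum_coe_sort E]
            · simp
          simp only [this, ← Finset.sum_mul]
          exact mul_le_of_le_one_left (by positivity)
            (sum_ite_le_of_injective ((hφi _).comp Subtype.val_injective) x)
        · exact (hzero z hz).le)
  refine ⟨P, le_trans ?_ (hP _ (fun φ => by
    split_ifs
    · exact Finset.sum_nonneg fun _ _ => by positivity
    · exact le_rfl) c)⟩
  have hout : ∀ i, (antiState fun z => u i z * c (g i z)) = (a i : ℂ) • antiState d := by
    intro i
    rw [← antiState_smul]
    congr 1
    funext z
    exact div_mul_cancel₀ _ (hc0 _)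
  have hnorm : ∀ i, normSq ((a i : ℂ) • antiState d) = 2 * (‖c i.1‖ ^ 2 * ‖c i.2‖ ^ 2 / D) := by
    intro i
    rw [← antiState_smul, normSq_antiState, ← ha]
    simp only [norm_mul, mul_pow, hd, Complex.norm_real, Real.norm_eq_abs, sq_abs,
      Finset.sum_const, Finset.card_univ, nsmul_eq_mul]
    simp
    field_simp
  have hval : ∀ i, (if ∃ b : ℂ, (antiState fun z => u i z * c (g i z)) = b • antiState d then
      normSq (antiState fun z => u i z * c (g i z)) else 0) =
      2 * (‖c i.1‖ ^ 2 * ‖c i.2‖ ^ 2 / D) := by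
    intro i
    rw [if_pos ⟨_, hout i⟩, hout, hnorm]
  simp only [hval, ← Finset.mul_sum, ← Finset.sum_div, Fintype.sum_prod_type]
  refine mul_le_mul_of_nonneg_left ?_ zero_le_two
  rw [← Finset.sum_mul, Finset.sum_coe_sort E fun x => ‖c x‖ ^ 2,
    Finset.sum_coe_sort O fun x => ‖c x‖ ^ 2, ← hWe, ← hWo, ← min_mul_max, ← hD]
  -- If `D = 0`, both weights vanish and the division by zero is harmless.
  rcases hD0.eq_or_lt with h | h
  · rw [← h, mul_zero, zero_div]
    exact min_le_max.trans h.ge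
  · rw [mul_div_cancel_right₀ _ h.ne']

theorem number_le {N : ℕ} (x : Occ N) : number x ≤ N := by
  have : ∀ a : Fin 2, (a : ℕ) ≤ 1 := by decide
  simpa [number] using Finset.sum_le_sum fun i (_ : i ∈ Finset.univ) => this (x i)

theorem prod_eq_of_number_eq (p : Fin 2 → ℝ) {N : ℕ} {x y : Occ N} (h : number x = number y) :
    ∏ i, p (x i) = ∏ i, p (y i) := by
  have key : ∀ x : Occ N, ∏ i, p (x i) = p 0 ^ (N - number x) * p 1 ^ number x := by
    intro x
    have h1 : number x + ∑ i, (1 - (x i : ℕ)) = N := by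
      rw [number, ← Finset.sum_add_distrib]
      have : ∀ a : Fin 2, (a : ℕ) + (1 - (a : ℕ)) = 1 := by decide
      simp [this]
    have h2 : N - number x = ∑ i, (1 - (x i : ℕ)) := by omega
    rw [h2, number, ← Finset.prod_pow_eq_pow_sum, ← Finset.prod_pow_eq_pow_sum,
      ← Finset.prod_mul_distrib]
    refine Finset.prod_congr rfl fun i _ => ?_
    generalize x i = a
    fin_cases a <;> simp
  rw [key, key, h]

/-- There are only `N + 1` possible fermion numbers, and each discarded class has fewer than `M`
elements. -/
theorem card_compl_largeClass_le (N M : ℕ) : (largeClass N M)ᶜ.card ≤ M * (N + 1) := by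
  have h := Finset.card_le_mul_card_image_of_maps_to (s := (largeClass N M)ᶜ) (f := number)
    (t := Finset.range (N + 1)) (fun x _ => Finset.mem_range.2 (Nat.lt_succ_of_le (number_le x))) M
    (fun w _ => by
      rcases ((largeClass N M)ᶜ.filter fun x => number x = w).eq_empty_or_nonempty with h | ⟨x, hx⟩
      · rw [h]; simp
      · obtain ⟨hx1, rfl⟩ := Finset.mem_filter.1 hx
        have hlt : (weightClass x).card < M := by simpa [largeClass] using hx1
        refine le_trans (Finset.card_le_card fun y hy => ?_) hlt.le
        simpa [weightClass] using (Finset.mem_filter.1 hy).2)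
  simpa using h

/-- The parity sign is a product over modes, so its expectation factorises; this is the difference
between the even and odd weights. -/
theorem sum_neg_one_pow_mul_prod (p : Fin 2 → ℝ) (N : ℕ) :
    ∑ x : Occ N, (-1) ^ number x * ∏ i, p (x i) = (p 0 - p 1) ^ N := by
  have : p 0 - p 1 = ∑ a : Fin 2, (-1) ^ (a : ℕ) * p a := by
    simp [Fin.sum_univ_two, sub_eq_add_neg]
  rw [this, Fintype.sum_pow]
  refine Finset.sum_congr rfl fun x _ => ?_
  rw [number, ← Finset.prod_pow_eq_pow_sum, Finset.prod_mul_distrib]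

/-- Both parities have probability close to one half. -/
theorem half_sub_le_sum_parity {p : Fin 2 → ℝ} (hp : ∑ a, p a = 1) (N : ℕ) :
    (1 - |p 0 - p 1| ^ N) / 2 ≤ ∑ x : Occ N with Even (number x), ∏ i, p (x i) ∧
    (1 - |p 0 - p 1| ^ N) / 2 ≤ ∑ x : Occ N with ¬ Even (number x), ∏ i, p (x i) := by
  have h1 := Finset.sum_filter_add_sum_filter_not Finset.univ (fun x : Occ N => Even (number x))
    fun x => ∏ i, p (x i)
  have h2 := Finset.sum_filter_add_sum_filter_not Finset.univ (fun x : Occ N => Even (number x))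
    fun x => (-1) ^ number x * ∏ i, p (x i)
  rw [sum_prod_eq_one hp] at h1
  rw [sum_neg_one_pow_mul_prod] at h2
  have h3 : ∑ x : Occ N with Even (number x), (-1) ^ number x * ∏ i, p (x i) =
      ∑ x : Occ N with Even (number x), ∏ i, p (x i) :=
    Finset.sum_congr rfl fun x hx => by rw [(Finset.mem_filter.1 hx).2.neg_one_pow, one_mul]
  have h4 : ∑ x : Occ N with ¬ Even (number x), (-1) ^ number x * ∏ i, p (x i) =
      -∑ x : Occ N with ¬ Even (number x), ∏ i, p (x i) := by
    rw [← Finset.sum_neg_distrib]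
    exact Finset.sum_congr rfl fun x hx => by
      rw [(Nat.not_even_iff_odd.1 (Finset.mem_filter.1 hx).2).neg_one_pow, neg_one_mul]
  rw [h3, h4] at h2
  have h5 := abs_le.1 (abs_pow (p 0 - p 1) N).le
  constructor <;> linarith [h5.1, h5.2]

/-- Split by typicality: atypical configurations have small total weight, and the few typical ones
in small classes each have small probability. -/
theorem sum_compl_largeClass_le {p : Fin 2 → ℝ} (hp0 : ∀ a, 0 ≤ p a) (hp : ∑ a, p a = 1)
    (δ : ℝ) (N M : ℕ) :
    ∑ x ∈ (largeClass N M)ᶜ, ∏ i, p (x i) ≤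
      (1 - ∑ x ∈ typical p δ N, ∏ i, p (x i)) +
        M * (N + 1) * Real.exp (-(N * (entropyNats p - δ))) := by
  have hP0 : ∀ x : Occ N, 0 ≤ ∏ i, p (x i) := fun x => Finset.prod_nonneg fun i _ => hp0 _
  have htot := Finset.sum_add_sum_compl (typical p δ N) fun x => ∏ i, p (x i)
  rw [sum_prod_eq_one hp] at htot
  rw [← Finset.sum_inter_add_sum_sdiff (largeClass N M)ᶜ (typical p δ N), add_comm]
  refine add_le_add ?_ ?_
  · rw [← htot, add_sub_cancel_left]
    refine Finset.sum_le_sum_of_subset_of_nonneg (fun x hx => ?_) fun x _ _ => hP0 x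
    exact Finset.mem_compl.2 (Finset.mem_sdiff.1 hx).2
  · refine (Finset.sum_le_card_nsmul _ _ _ fun x hx =>
      prod_le_of_mem_typical (Finset.mem_inter.1 hx).2).trans ?_
    rw [nsmul_eq_mul]
    refine mul_le_mul_of_nonneg_right ?_ (Real.exp_pos _).le
    exact_mod_cast (Finset.card_le_card Finset.inter_subset_left).trans
      (card_compl_largeClass_le N M)

theorem le_sum_largeClass {p : Fin 2 → ℝ} (hp0 : ∀ a, 0 ≤ p a) (N M : ℕ)
    (r : Occ N → Prop) [DecidablePred r] :
    ∑ x with r x, ∏ i, p (x i) - ∑ x ∈ (largeClass N M)ᶜ, ∏ i, p (x i) ≤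
      ∑ x ∈ largeClass N M with r x, ∏ i, p (x i) := by
  have hP0 : ∀ x : Occ N, 0 ≤ ∏ i, p (x i) := fun x => Finset.prod_nonneg fun i _ => hp0 _
  rw [sub_le_iff_le_add, ← Finset.sum_filter_add_sum_filter_not (Finset.univ.filter r)
    (fun x => x ∈ largeClass N M)]
  refine add_le_add ?_ ?_ <;>
    refine Finset.sum_le_sum_of_subset_of_nonneg (fun x hx => ?_) fun x _ _ => hP0 x
  · simp only [Finset.mem_filter] at hx ⊢
    exact ⟨hx.2, hx.1.2⟩
  · simp only [Finset.mem_filter] at hx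
    exact Finset.mem_compl.2 hx.2

/-- Measuring all modes. -/
theorem exists_trivial_protocol {N : ℕ} {c : Occ N → ℂ} (hc : ∑ x, ‖c x‖ ^ 2 = 1)
    (d : Occ 0 → ℂ) (hd : ∀ z, ‖d z‖ ^ 2 = 1) :
    ∃ P : LOCC 0 0 N N, 1 ≤ P.successProb (antiState c) (antiState d) := by
  classical
  have hd0 : d 0 ≠ 0 := fun h => by
    have h1 := hd 0
    rw [h] at h1
    simp at h1
  obtain ⟨P, hP⟩ := exists_protocol (m := 0) (fun (i : Occ N) _ => i) (fun _ _ => 1)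
    (fun i => ⟨(-1) ^ number i, neg_one_pow_eq_or_neg _, fun z _ => by simp [number]⟩)
    (fun i z z' _ _ _ => Subsingleton.elim _ _) (fun x => by simp)
  refine ⟨P, le_trans (le_of_eq ?_) (hP _ (fun φ => by
    split_ifs
    · exact Finset.sum_nonneg fun _ _ => by positivity
    · exact le_rfl) c)⟩
  have hout : ∀ i, (antiState fun _ : Occ 0 => 1 * c i) = (c i / d 0) • antiState d := by
    intro i
    rw [← antiState_smul]
    congr 1
    funext z
    rw [Subsingleton.elim z 0, div_mul_cancel₀ _ hd0, one_mul]
  have hval : ∀ i, (if ∃ b : ℂ, (antiState fun _ : Occ 0 => 1 * c i) = b • antiState d then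
      normSq (antiState fun _ : Occ 0 => 1 * c i) else 0) = ‖c i‖ ^ 2 := by
    intro i
    rw [if_pos ⟨_, hout i⟩, normSq_antiState]
    simp
  simp only [hval, hc]

theorem exists_pow_and_exp_le {r δ η : ℝ} (hr0 : 0 ≤ r) (hr : r < 1) (hδ : 0 < δ) (hη : 0 < η) :
    ∃ N₀ : ℕ, ∀ N : ℕ, N₀ ≤ N → r ^ N ≤ η ∧ (N + 1) * Real.exp (-(N * δ)) ≤ η := by
  have h1 := tendsto_pow_atTop_nhds_zero_of_lt_one hr0 hr
  have hq : Real.exp (-δ) < 1 := by rw [Real.exp_lt_one_iff]; linarith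
  have h2 := (tendsto_self_mul_const_pow_of_lt_one (Real.exp_pos _).le hq).add
    (tendsto_pow_atTop_nhds_zero_of_lt_one (Real.exp_pos _).le hq)
  rw [add_zero] at h2
  obtain ⟨N₀, h⟩ := Filter.eventually_atTop.1
    ((h1.eventually_le_const hη).and (h2.eventually_le_const hη))
  refine ⟨N₀, fun N hN => ⟨(h N hN).1, le_trans (le_of_eq ?_) (h N hN).2⟩⟩
  rw [← mul_neg, Real.exp_nat_mul]
  ring

theorem entropyNats_pos {p : Fin 2 → ℝ} (hp0 : ∀ a, 0 < p a) (hp : ∑ a, p a = 1) :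
    0 < entropyNats p := by
  rw [Fin.sum_univ_two] at hp
  have h : ∀ a, 0 < Real.negMulLog (p a) := by
    intro a
    have hlt : p a < 1 := by
      have := hp0 0; have := hp0 1
      fin_cases a <;> simp <;> linarith
    rw [Real.negMulLog, neg_mul, neg_pos]
    exact mul_neg_of_pos_of_neg (hp0 a) (Real.log_neg (hp0 a) hlt)
  exact Finset.sum_pos (fun a _ => h a) Finset.univ_nonempty

theorem entanglementEntropy_eModes_one_of_eq_zero {α β : ℂ} (hαβ : ‖α‖ ^ 2 + ‖β‖ ^ 2 = 1)
    (h : α = 0 ∨ β = 0) : entanglementEntropy (eModes α β 1) = 0 := by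
  rw [entanglementEntropy_eModes_one]
  rcases h with rfl | rfl
  · have : ‖β‖ ^ 2 = 1 := by simpa using hαβ
    simp [occProb, Fin.sum_univ_two, this]
  · have : ‖α‖ ^ 2 = 1 := by simpa using hαβ
    simp [occProb, Fin.sum_univ_two, this]

theorem concentration {α β : ℂ} (hαβ : ‖α‖ ^ 2 + ‖β‖ ^ 2 = 1) {ε : ℝ} (hε : 0 < ε) :
    ∃ N₀ : ℕ, ∀ N : ℕ, N₀ ≤ N →
      ∃ k : ℕ, |(k : ℝ) - N * entanglementEntropy (eModes α β 1)| ≤ ε * N ∧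
        ∃ P : LOCC k k N N, 1 - ε ≤ P.successProb (eModes α β N) (perfectEModes k) := by
  -- Here the parity of Alice's modes is deterministic, so the two parity sectors do not equalise;
  -- the entropy is zero and no e-mode is needed.
  by_cases hdeg : α = 0 ∨ β = 0
  · refine ⟨0, fun N _ => ⟨0, ?_, ?_⟩⟩
    · rw [entanglementEntropy_eModes_one_of_eq_zero hαβ hdeg]
      simp only [Nat.cast_zero, mul_zero, sub_zero, abs_zero]
      positivity
    · obtain ⟨P, hP⟩ := exists_trivial_protocol (sum_norm_sq_eAmplitude hαβ N) _
        (fun z => (norm_sq_eAmplitude_perfect 0 z).trans (by simp))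
      refine ⟨P, ?_⟩
      rw [perfectEModes, eModes_eq_antiState, eModes_eq_antiState _ _ 0]
      linarith
  push Not at hdeg
  have hlog : 0 < Real.log 2 := Real.log_pos one_lt_two
  have hp := sum_occProb hαβ
  have hppos : ∀ a, 0 < occProb α β a := fun a => by
    have h1 := norm_pos_iff.2 hdeg.1
    have h2 := norm_pos_iff.2 hdeg.2
    unfold occProb
    split_ifs <;> positivity
  have hp0 : ∀ a, 0 ≤ occProb α β a := fun a => (hppos a).le
  have hH := entropyNats_pos hppos hp
  have hS : entanglementEntropy (eModes α β 1) = entropyNats (occProb α β) / Real.log 2 :=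
    entanglementEntropy_eModes_one α β
  have hc0 : ∀ N (x : Occ N), eAmplitude α β N x ≠ 0 := fun N x h => by
    have h1 := norm_sq_eAmplitude α β N x
    have h2 : 0 < ∏ i, occProb α β (x i) := Finset.prod_pos fun i _ => hppos _
    rw [← h1, h] at h2
    simp at h2
  have hcn : ∀ N (x y : Occ N), number x = number y →
      ‖eAmplitude α β N x‖ ^ 2 = ‖eAmplitude α β N y‖ ^ 2 := fun N x y h => by
    rw [norm_sq_eAmplitude, norm_sq_eAmplitude, prod_eq_of_number_eq _ h]
  set p := occProb α β with hpdef
  set H := entropyNats p with hHdef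
  -- `H / 2` makes `t` nonnegative; the second bound limits the rate loss `2 * δ / log 2` to `ε /
  -- 2`.
  set δ := min (H / 2) (ε * Real.log 2 / 4) with hδ
  have hδ0 : 0 < δ := by positivity
  have hδH : δ ≤ H / 2 := min_le_left _ _
  have hδε : δ ≤ ε * Real.log 2 / 4 := min_le_right _ _
  have hr : |p 0 - p 1| < 1 := by
    rw [Fin.sum_univ_two] at hp
    rw [abs_lt]
    constructor <;> linarith [hppos 0, hppos 1]
  obtain ⟨N₁, hN₁⟩ := exists_sum_typical_ge hp0 hp hδ0 (by positivity : 0 < ε / 4)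
  obtain ⟨N₂, hN₂⟩ := exists_nat_gt (4 / ε)
  obtain ⟨N₃, hN₃⟩ := exists_pow_and_exp_le (abs_nonneg _) hr hδ0 (by positivity : 0 < ε / 8)
  refine ⟨max N₁ (max N₂ N₃), fun N hN => ?_⟩
  have hN4 : 4 < ε * N := by
    have : 4 / ε < N := hN₂.trans_le (by
      exact_mod_cast le_of_max_le_left (le_of_max_le_right hN))
    rwa [div_lt_iff₀' hε] at this
  have htyp := hN₁ N (le_of_max_le_left hN)
  obtain ⟨hpow, hexp⟩ := hN₃ N (le_of_max_le_right (le_of_max_le_right hN))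
  -- Blocks of about `exp (N (H - 2δ))` configurations lie a factor `exp (-N δ)` below the inverse
  -- of the typical probability bound, which beats the `N + 1` classes.
  set t := N * (H - 2 * δ) / Real.log 2 with ht
  have ht0 : 0 ≤ t := div_nonneg (mul_nonneg (Nat.cast_nonneg _) (by linarith)) hlog.le
  refine ⟨⌊t⌋₊ + 1, ?_, ?_⟩
  · have h1 := Nat.floor_le ht0
    have h2 := Nat.lt_floor_add_one t
    have h3 : t = N * (H / Real.log 2) - N * (2 * δ / Real.log 2) := by
      rw [ht]; field_simp
    have h4 : 2 * δ / Real.log 2 ≤ ε / 2 := by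
      rw [div_le_iff₀ hlog]; linarith
    have h5 : N * (2 * δ / Real.log 2) ≤ N * (ε / 2) :=
      mul_le_mul_of_nonneg_left h4 (Nat.cast_nonneg _)
    have h6 : 0 ≤ N * (2 * δ / Real.log 2) := by positivity
    rw [hS]
    push_cast
    rw [abs_le]
    constructor <;> linarith
  · obtain ⟨P, hP⟩ := exists_concentration_protocol (hc0 N) (hcn N)
      (norm_sq_eAmplitude_perfect (⌊t⌋₊ + 1))
    refine ⟨P, ?_⟩
    rw [perfectEModes, eModes_eq_antiState, eModes_eq_antiState _ _ (⌊t⌋₊ + 1)]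
    refine le_trans ?_ hP
    simp only [norm_sq_eAmplitude]
    have hM : ((2 ^ ⌊t⌋₊ : ℕ) : ℝ) ≤ Real.exp (N * (H - 2 * δ)) := by
      push_cast
      rw [← Real.rpow_natCast, Real.rpow_def_of_pos two_pos, Real.exp_le_exp, mul_comm (Real.log 2),
        ← le_div_iff₀ hlog]
      exact Nat.floor_le ht0
    have hsmall : ((2 ^ ⌊t⌋₊ : ℕ) : ℝ) * (N + 1) * Real.exp (-(N * (H - δ))) ≤ ε / 8 := by
      refine le_trans ?_ hexp
      calc ((2 ^ ⌊t⌋₊ : ℕ) : ℝ) * (N + 1) * Real.exp (-(N * (H - δ)))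
          ≤ Real.exp (N * (H - 2 * δ)) * (N + 1) * Real.exp (-(N * (H - δ))) := by gcongr
        _ = (N + 1) * (Real.exp (N * (H - 2 * δ)) * Real.exp (-(N * (H - δ)))) := by ring
        _ = (N + 1) * Real.exp (-(N * δ)) := by
          rw [← Real.exp_add]
          congr 2
          ring
    have hcompl := sum_compl_largeClass_le hp0 hp δ N (2 ^ ⌊t⌋₊)
    obtain ⟨he, ho⟩ := half_sub_le_sum_parity hp N
    have he' := le_sum_largeClass hp0 N (2 ^ ⌊t⌋₊) fun x => Even (number x)
    have ho' := le_sum_largeClass hp0 N (2 ^ ⌊t⌋₊) fun x => ¬ Even (number x)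
    have hmin : (1 - ε) / 2 ≤ min (∑ x ∈ largeClass N (2 ^ ⌊t⌋₊) with Even (number x),
        ∏ i, p (x i)) (∑ x ∈ largeClass N (2 ^ ⌊t⌋₊) with ¬ Even (number x), ∏ i, p (x i)) :=
      -- The losses from 1/2 are ε/16 (parity bias), ε/4 (atypical) and ε/8 (small classes),
      -- together below ε/2.
      le_min (by linarith) (by linarith)
    linarith

end Fermion

end

theorem theorem2 (α β : ℂ) (hαβ : ‖α‖ ^ 2 + ‖β‖ ^ 2 = 1) :
    -- concentration
    (∀ ε : ℝ, 0 < ε → ∃ N₀ : ℕ, ∀ N : ℕ, N₀ ≤ N →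
      ∃ k : ℕ, |(k : ℝ) - N * Fermion.entanglementEntropy (Fermion.eModes α β 1)| ≤ ε * N ∧
        ∃ P : Fermion.LOCC k k N N,
          1 - ε ≤ P.successProb (Fermion.eModes α β N) (Fermion.perfectEModes k)) ∧
    -- dilution
    (∀ ε : ℝ, 0 < ε → ∃ N₀ : ℕ, ∀ N : ℕ, N₀ ≤ N →
      ∃ k : ℕ, |(k : ℝ) - N * Fermion.entanglementEntropy (Fermion.eModes α β 1)| ≤ ε * N ∧
        ∃ P : Fermion.LOCC N N k k,
          1 - ε ≤ P.fidelity (Fermion.perfectEModes k) (Fermion.eModes α β N)) :=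
  ⟨fun _ hε => Fermion.concentration hαβ hε, fun _ hε => Fermion.dilution hαβ hε⟩
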